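/- Let $\mathfrak A$ be a (not necessarily unital) C*-algebra and let $\mathfrak M\subseteq\mathfrak A$ be an Abelian C*-subalgebra which contains an approximate identity for $\mathfrak A$; that is, $(\mathfrak A,\mathfrak M)$ is a topographic quantum space. Let $\mathscr S(\mathfrak A)$ be the state space of $\mathfrak A$ (the positive linear functionals of norm one on $\mathfrak A$), and let $\sigma(\mathfrak M)$ be the Gel'fand spectrum of $\mathfrak M$ with its weak* topology. For $\varphi\in\mathscr S(\mathfrak A)$ and $K\subseteq\sigma(\mathfrak M)$ compact, write $$\varphi(1-\mathbf 1_K)=1-\mu_\varphi(K),$$ where $\mu_\varphi$ is the unique Radon probability measure on $\sigma(\mathfrak M)$ with $\varphi(m)=\int_{\sigma(\mathfrak M)}\chi(m)\,d\mu_\varphi(\chi)$ for all $m\in\mathfrak M$ (equivalently, evaluate at $1-\mathbf 1_K\in\mathfrak A^{**}$ the normal extension of $\varphi$). A set $\mathscr K\subseteq\mathscr S(\mathfrak A)$ is called tight when for every $\varepsilon>0$ there is a compact set $Q\subseteq\sigma(\mathfrak M)$ such that for every compact set $K\subseteq\sigma(\mathfrak M)$ with $Q\subseteq K$, $$\sup\{\varphi(1-\mathbf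 1_K):\varphi\in\mathscr K\}<\varepsilon$$ (the supremum of the empty set being $0$). Theorem. A set $\mathscr K\subseteq\mathscr S(\mathfrak A)$ is tight if and only if its weak* closure in the dual $\mathfrak A^*$ is contained in $\mathscr S(\mathfrak A)$ and is weak* compact. -/

import Mathlib

open MeasureTheory Filter
open scoped ComplexOrder

noncomputable section

namespace TopographicQuantumSpace

variable {A : Type*} [NonUnitalCStarAlgebra A]

/-- `IsTopography M` says that `(A, M)` is a topographic quantum space: `M` is an Abelian
C*-subalgebra of the (possibly non-unital) C*-algebra `A` which contains an approximate identity
for `A`. The approximate identity is a filter on `A` that lives on `M`, for instance the image of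
the tail filter of a net in `M`. -/
structure IsTopography (M : NonUnitalStarSubalgebra ℂ A) : Prop where
  isClosed : IsClosed (M : Set A)
  abelian : ∀ x ∈ M, ∀ y ∈ M, x * y = y * x
  exists_approximateUnit : ∃ l : Filter A, l.IsApproximateUnit ∧ (M : Set A) ∈ l

variable (A) in
/-- The state space of `A`: the positive linear functionals of norm one, as a subset of the
topological dual of `A` with its weak* topology. -/
def stateSpace : Set (WeakDual ℂ A) :=
  {φ | (∀ a : A, 0 ≤ φ (star a * a)) ∧ ‖WeakDual.toStrongDual φ‖ = 1}

/-- The Gel'fand spectrum of `M`: the nonzero multiplicative linear functionals on `M`, with the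
weak* topology. -/
abbrev GelfandSpectrum (M : NonUnitalStarSubalgebra ℂ A) : Type _ :=
  ↥(WeakDual.characterSpace ℂ M)

/-- The Gel'fand spectrum carries its Borel sigma-algebra. -/
instance instMeasurableSpaceGelfandSpectrum (M : NonUnitalStarSubalgebra ℂ A) :
    MeasurableSpace (GelfandSpectrum M) :=
  borel _

instance instBorelSpaceGelfandSpectrum (M : NonUnitalStarSubalgebra ℂ A) :
    BorelSpace (GelfandSpectrum M) :=
  ⟨rfl⟩

/-- `Represents M φ μ` says that `μ` is a Radon probability measure on the Gel'fand spectrum of `M`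
and that the restriction of `φ` to `M` is the integral against `μ`, where `m` in `M` is seen as
the function `χ ↦ χ m` on the spectrum. -/
structure Represents (M : NonUnitalStarSubalgebra ℂ A) (φ : WeakDual ℂ A)
    (μ : Measure (GelfandSpectrum M)) : Prop where
  isProbabilityMeasure : IsProbabilityMeasure μ
  regular : μ.Regular
  integral_eq : ∀ m : M, ∫ χ : GelfandSpectrum M, χ m ∂μ = φ (m : A)

open Classical in
/-- The Radon probability measure on the Gel'fand spectrum of `M` which represents the restriction
of `φ` to `M`. By the Riesz representation theorem exactly one such measure exists when `φ` is a
state of `A` and `M` is a topography; the value `0` is a default for the other functionals. -/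
def stateMeasure (M : NonUnitalStarSubalgebra ℂ A) (φ : WeakDual ℂ A) :
    Measure (GelfandSpectrum M) :=
  if h : ∃ μ : Measure (GelfandSpectrum M), Represents M φ μ then h.choose else 0

/-- The number `φ(1 - 1_K)` for a state `φ` of `A` and a compact subset `K` of the Gel'fand
spectrum of `M`. Here `φ(1) = 1`, and the value at the indicator function `1_K` (an element of the
bidual of `M`, hence of the bidual of `A`) of the normal extension of `φ` is the measure of `K` for
the measure representing `φ` on `M`. -/
def massOutside (M : NonUnitalStarSubalgebra ℂ A) (φ : WeakDual ℂ A)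
    (K : Set (GelfandSpectrum M)) : ℝ :=
  1 - (stateMeasure M φ).real K

/-- A set `S` of states of `A` is tight when for every `ε > 0` there is a compact subset `Q` of the
Gel'fand spectrum of `M` such that `sup {φ(1 - 1_K) : φ ∈ S} < ε` for every compact `K ⊇ Q`. -/
def IsTight (M : NonUnitalStarSubalgebra ℂ A) (S : Set (WeakDual ℂ A)) : Prop :=
  ∀ ε : ℝ, 0 < ε → ∃ Q : Set (GelfandSpectrum M), IsCompact Q ∧
    ∀ K : Set (GelfandSpectrum M), IsCompact K → Q ⊆ K →
      sSup ((fun φ => massOutside M φ K) '' S) < ε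

end TopographicQuantumSpace

end

/-! The state space can fail to be weak* closed only because norm one may drop in a limit:
positivity and norm at most one are weak* closed conditions, and Banach–Alaoglu makes every closure
of a set of states compact. Tightness is exactly what prevents this loss of mass.

The link is a sandwich. If `m` in `M` has Gel'fand transform `f` with values in [0, 1], compact
support and `f = 1` on `K`, then μ_φ(K) ≤ φ(m) ≤ μ_φ(supp f). The middle term is weak* continuous in
φ, so lower bounds on masses pass to limits in one direction and spread to weak* neighbourhoods in
the other, where compactness makes them uniform.

This needs two facts: Gel'fand duality for `M`, obtained from its unitization, and ‖φ|_M‖ = 1 for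
every state φ, which makes the Riesz measure a probability measure. The second comes from
Cauchy–Schwarz and the approximate identity in `M`. -/

noncomputable section

/-! ### Gel'fand duality without a unit, via the unitization -/

namespace NonUnitalGelfand

open WeakDual Topology

variable {B : Type*} [NonUnitalCommCStarAlgebra B]

/-- The unique extension of a character of `B` to a character of the unitization of `B`. -/
def unitizationLift (χ : characterSpace ℂ B) : characterSpace ℂ (Unitization ℂ B) :=
  CharacterSpace.equivAlgHom.symm (Unitization.lift (CharacterSpace.toNonUnitalAlgHom χ))

theorem unitizationLift_apply (χ : characterSpace ℂ B) (x : Unitization ℂ B) :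
    unitizationLift χ x = x.fst + χ x.snd :=
  rfl

@[simp]
theorem unitizationLift_inr (χ : characterSpace ℂ B) (b : B) :
    unitizationLift χ (b : Unitization ℂ B) = χ b := by
  simp [unitizationLift_apply]

/-- The character of the unitization whose kernel is `B`. -/
def characterAtInfinity : characterSpace ℂ (Unitization ℂ B) :=
  CharacterSpace.equivAlgHom.symm (Unitization.fstHom ℂ B)

theorem characterAtInfinity_apply (x : Unitization ℂ B) : characterAtInfinity x = x.fst :=
  rfl

/-- A unital character is determined by its restriction to `B`, and this restriction is either zero
or itself a character. -/
theorem eq_characterAtInfinity_or_mem_range (ψ : characterSpace ℂ (Unitization ℂ B)) :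
    ψ = characterAtInfinity ∨ ψ ∈ Set.range unitizationLift := by
  have hψ : ∀ x : Unitization ℂ B, ψ x = x.fst + ψ (x.snd : Unitization ℂ B) := fun x => by
    conv_lhs => rw [← Unitization.inl_fst_add_inr_snd_eq x]
    rw [map_add]
    congr 1
    exact AlgHomClass.commutes ψ x.fst
  have hcont : Continuous fun b : B => ψ (b : Unitization ℂ B) :=
    (map_continuous ψ).comp (Unitization.isometry_inr (𝕜 := ℂ) (A := B)).continuous
  let ρ : WeakDual ℂ B :=
    (⟨{ toFun := fun b : B => ψ (b : Unitization ℂ B)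
        map_add' := fun a b => by simp
        map_smul' := fun c a => by simp }, hcont⟩ : B →L[ℂ] ℂ)
  have hρ : ∀ b : B, ρ b = ψ (b : Unitization ℂ B) := fun b => rfl
  by_cases h0 : ρ = 0
  · left
    refine CharacterSpace.ext fun x => ?_
    rw [hψ, ← hρ, h0, characterAtInfinity_apply]
    exact add_zero _
  · right
    refine ⟨⟨ρ, h0, fun a b => ?_⟩, ?_⟩
    · rw [hρ, hρ, hρ, Unitization.inr_mul, map_mul]
    · refine CharacterSpace.ext fun x => ?_
      rw [hψ, unitizationLift_apply]
      rfl

theorem unitizationLift_ne_characterAtInfinity (χ : characterSpace ℂ B) :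
    unitizationLift χ ≠ characterAtInfinity := fun h => by
  refine χ.2.1 (ContinuousLinearMap.ext fun b => ?_)
  have := congrArg (fun ψ : characterSpace ℂ (Unitization ℂ B) => ψ (b : Unitization ℂ B)) h
  rw [unitizationLift_inr, characterAtInfinity_apply, Unitization.fst_inr] at this
  exact this

theorem range_unitizationLift :
    Set.range (unitizationLift (B := B)) = {characterAtInfinity}ᶜ := by
  ext ψ
  constructor
  · rintro ⟨χ, rfl⟩
    exact unitizationLift_ne_characterAtInfinity χ
  · intro h
    exact (eq_characterAtInfinity_or_mem_range ψ).resolve_left h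

theorem continuous_apply (b : B) : Continuous fun χ : characterSpace ℂ B => χ b :=
  (WeakDual.eval_continuous b).comp continuous_subtype_val

/-- Restriction to `B` is a continuous left inverse, which gives the embedding; the range is open
because it omits a single point of a Hausdorff space. -/
theorem isOpenEmbedding_unitizationLift : IsOpenEmbedding (unitizationLift (B := B)) := by
  have hc : Continuous (unitizationLift (B := B)) := by
    refine Continuous.subtype_mk (WeakDual.continuous_of_continuous_eval fun x => ?_) _
    exact continuous_const.add (continuous_apply x.snd)
  have hinr : Continuous (Unitization.inr : B → Unitization ℂ B) :=
    (Unitization.isometry_inr (𝕜 := ℂ) (A := B)).continuous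
  let r : characterSpace ℂ (Unitization ℂ B) → WeakDual ℂ B := fun ψ =>
    (⟨{ toFun := fun b : B => ψ (b : Unitization ℂ B)
        map_add' := fun a b => by simp
        map_smul' := fun c a => by simp }, (map_continuous ψ).comp hinr⟩ : B →L[ℂ] ℂ)
  have hr : Continuous r := WeakDual.continuous_of_continuous_eval fun b =>
    (WeakDual.eval_continuous (b : Unitization ℂ B)).comp continuous_subtype_val
  have hcomp : r ∘ unitizationLift = (Subtype.val : characterSpace ℂ B → WeakDual ℂ B) := by
    funext χ
    exact ContinuousLinearMap.ext fun b => unitizationLift_inr χ b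
  have hemb : IsEmbedding (r ∘ unitizationLift (B := B)) := hcomp ▸ IsEmbedding.subtypeVal
  refine ⟨IsEmbedding.of_comp hc hr hemb, ?_⟩
  rw [range_unitizationLift]
  exact isOpen_compl_singleton

theorem apply_star (χ : characterSpace ℂ B) (b : B) : χ (star b) = star (χ b) := by
  rw [← unitizationLift_inr, Unitization.inr_star, map_star, unitizationLift_inr]

theorem norm_apply_le (χ : characterSpace ℂ B) (b : B) : ‖χ b‖ ≤ ‖b‖ := by
  rw [← unitizationLift_inr, ← Unitization.norm_inr (𝕜 := ℂ) b]
  exact AlgHom.norm_apply_le_self (unitizationLift χ) _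

/-- The Gel'fand transform of the unitization is isometric, and the extra character at infinity
vanishes on `B`. Hence only `0 ≤ C` is needed there. -/
theorem norm_le_of_forall_norm_apply_le {b : B} {C : ℝ} (hC : 0 ≤ C)
    (h : ∀ χ : characterSpace ℂ B, ‖χ b‖ ≤ C) : ‖b‖ ≤ C := by
  rw [← Unitization.norm_inr (𝕜 := ℂ) b,
    ← (gelfandTransform_isometry (Unitization ℂ B)).norm_map_of_map_zero (map_zero _),
    ContinuousMap.norm_le _ hC]
  intro ψ
  change ‖ψ (b : Unitization ℂ B)‖ ≤ C
  rcases eq_characterAtInfinity_or_mem_range ψ with rfl | ⟨χ, rfl⟩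
  · simpa [characterAtInfinity_apply] using hC
  · simpa using h χ

theorem eq_of_forall_apply_eq {a b : B} (h : ∀ χ : characterSpace ℂ B, χ a = χ b) : a = b := by
  rw [← sub_eq_zero, ← norm_le_zero_iff]
  exact norm_le_of_forall_norm_apply_le le_rfl fun χ => by simp [h χ]

/-- Extended by zero, `f` is the transform of some `x` in the unitization; vanishing at infinity
says that the scalar part of `x` is zero. -/
theorem exists_apply_eq {f : characterSpace ℂ B → ℂ} (hf : Continuous f)
    (hs : HasCompactSupport f) : ∃ b : B, ∀ χ : characterSpace ℂ B, χ b = f χ := by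
  have hι := isOpenEmbedding_unitizationLift (B := B)
  have hg : Continuous (Function.extend unitizationLift f 0) := by
    refine continuous_of_tsupport fun ψ hψ => ?_
    obtain ⟨χ, -, rfl⟩ := hs.tsupport_extend_zero_subset hι.continuous hψ
    rw [← hι.continuousAt_iff, Function.extend_comp hι.injective]
    exact hf.continuousAt
  obtain ⟨x, hx⟩ := (gelfandTransform_bijective (Unitization ℂ B)).2 ⟨_, hg⟩
  have hx' : ∀ ψ : characterSpace ℂ (Unitization ℂ B),
      ψ x = Function.extend unitizationLift f 0 ψ := fun ψ => DFunLike.congr_fun hx ψ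
  have h0 : x.fst = 0 := by
    rw [← characterAtInfinity_apply, hx', Function.extend_apply']
    · rfl
    · rintro ⟨χ, hχ⟩
      exact unitizationLift_ne_characterAtInfinity χ hχ
  refine ⟨x.snd, fun χ => ?_⟩
  have := hx' (unitizationLift χ)
  rwa [hι.injective.extend_apply, unitizationLift_apply, h0, zero_add] at this

/-- The corresponding set for the unitization is closed in a compact space, and it misses the point
at infinity because `δ > 0`. -/
theorem isCompact_le_norm_apply (b : B) {δ : ℝ} (hδ : 0 < δ) :
    IsCompact {χ : characterSpace ℂ B | δ ≤ ‖χ b‖} := by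
  have hK : IsCompact {ψ : characterSpace ℂ (Unitization ℂ B) | δ ≤ ‖ψ (b : Unitization ℂ B)‖} :=
    (isClosed_le continuous_const
      ((WeakDual.eval_continuous (b : Unitization ℂ B)).comp
        continuous_subtype_val).norm).isCompact
  rw [← isOpenEmbedding_unitizationLift.isInducing.isCompact_preimage_iff] at hK
  · simpa using hK
  · rw [range_unitizationLift]
    rintro ψ hψ rfl
    exact absurd hψ (by simpa [characterAtInfinity_apply] using hδ)

instance : LocallyCompactSpace (characterSpace ℂ B) :=
  (isOpenEmbedding_unitizationLift (B := B)).locallyCompactSpace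

end NonUnitalGelfand

end

/-! ### Riesz representation on the spectrum -/

noncomputable section

namespace NonUnitalGelfand

open WeakDual Topology CompactlySupported

variable {B : Type*} [NonUnitalCommCStarAlgebra B]

/-- The inverse Gel'fand transform of a compactly supported real function. -/
def ofCompactlySupported (f : C_c(characterSpace ℂ B, ℝ)) : B :=
  (exists_apply_eq (f := fun χ => (f χ : ℂ)) (Complex.continuous_ofReal.comp f.continuous)
    (f.hasCompactSupport.comp_left Complex.ofReal_zero)).choose

@[simp]
theorem apply_ofCompactlySupported (f : C_c(characterSpace ℂ B, ℝ)) (χ : characterSpace ℂ B) :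
    χ (ofCompactlySupported f) = f χ :=
  (exists_apply_eq (f := fun χ => (f χ : ℂ)) (Complex.continuous_ofReal.comp f.continuous)
    (f.hasCompactSupport.comp_left Complex.ofReal_zero)).choose_spec χ

theorem norm_ofCompactlySupported_le {f : C_c(characterSpace ℂ B, ℝ)} {C : ℝ} (hC : 0 ≤ C)
    (h : ∀ χ, |f χ| ≤ C) : ‖ofCompactlySupported f‖ ≤ C :=
  norm_le_of_forall_norm_apply_le hC fun χ => by
    simpa using h χ

theorem ofCompactlySupported_add (f g : C_c(characterSpace ℂ B, ℝ)) :
    ofCompactlySupported (f + g) = ofCompactlySupported f + ofCompactlySupported g :=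
  eq_of_forall_apply_eq fun χ => by simp

theorem ofCompactlySupported_smul (c : ℝ) (f : C_c(characterSpace ℂ B, ℝ)) :
    ofCompactlySupported (c • f) = (c : ℂ) • ofCompactlySupported f :=
  eq_of_forall_apply_eq fun χ => by
    rw [map_smul, apply_ofCompactlySupported, apply_ofCompactlySupported]
    simp

/-- A nonnegative compactly supported function corresponds to an element `star b * b`. -/
theorem exists_star_mul_self_eq_ofCompactlySupported {f : C_c(characterSpace ℂ B, ℝ)}
    (hf : 0 ≤ f) : ∃ b : B, star b * b = ofCompactlySupported f := by
  let g : C_c(characterSpace ℂ B, ℝ) :=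
    ⟨⟨fun χ => √(f χ), Real.continuous_sqrt.comp f.continuous⟩,
      f.hasCompactSupport.comp_left Real.sqrt_zero⟩
  refine ⟨ofCompactlySupported g, eq_of_forall_apply_eq fun χ => ?_⟩
  have h : √(f χ) * √(f χ) = f χ := Real.mul_self_sqrt (hf χ)
  rw [map_mul, apply_star, apply_ofCompactlySupported, apply_ofCompactlySupported]
  change star ((√(f χ) : ℝ) : ℂ) * ((√(f χ) : ℝ) : ℂ) = _
  rw [Complex.star_def, Complex.conj_ofReal, ← Complex.ofReal_mul, h]

/-- Urysohn's lemma on the spectrum. -/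
theorem exists_compactlySupported_eq_one {K : Set (characterSpace ℂ B)} (hK : IsCompact K) :
    ∃ f : C_c(characterSpace ℂ B, ℝ), (∀ χ ∈ K, f χ = 1) ∧ ∀ χ, 0 ≤ f χ ∧ f χ ≤ 1 := by
  obtain ⟨f, h1, -, hs, h01⟩ :=
    exists_continuous_one_zero_of_isCompact hK isClosed_empty (Set.disjoint_empty K)
  exact ⟨⟨f, hs⟩, h1, h01⟩

/-- Every element is a limit of elements whose Gel'fand transform has compact support. -/
theorem exists_norm_sub_le (b : B) {ε : ℝ} (hε : 0 < ε) :
    ∃ f g : C_c(characterSpace ℂ B, ℝ),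
      ‖b - (ofCompactlySupported f + Complex.I • ofCompactlySupported g)‖ ≤ ε := by
  -- Multiplying by `u` changes nothing where `ε ≤ ‖χ b‖`, and elsewhere costs at most `ε`.
  obtain ⟨u, hu, hu01⟩ := exists_compactlySupported_eq_one (isCompact_le_norm_apply b hε)
  let f : C_c(characterSpace ℂ B, ℝ) :=
    ⟨⟨fun χ => u χ * (χ b).re, u.continuous.mul (Complex.continuous_re.comp (continuous_apply b))⟩,
      u.hasCompactSupport.mul_right⟩
  let g : C_c(characterSpace ℂ B, ℝ) :=
    ⟨⟨fun χ => u χ * (χ b).im, u.continuous.mul (Complex.continuous_im.comp (continuous_apply b))⟩,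
      u.hasCompactSupport.mul_right⟩
  refine ⟨f, g, norm_le_of_forall_norm_apply_le hε.le fun χ => ?_⟩
  have h : χ (b - (ofCompactlySupported f + Complex.I • ofCompactlySupported g))
      = ((1 - u χ : ℝ) : ℂ) * χ b := by
    rw [map_sub, map_add, map_smul, apply_ofCompactlySupported, apply_ofCompactlySupported]
    change χ b - (((u χ * (χ b).re : ℝ) : ℂ) + Complex.I • ((u χ * (χ b).im : ℝ) : ℂ)) = _
    apply Complex.ext <;> simp <;> ring
  rw [h, norm_mul, Complex.norm_real, Real.norm_of_nonneg (sub_nonneg.2 (hu01 χ).2)]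
  by_cases hχ : ε ≤ ‖χ b‖
  · rw [hu χ hχ, sub_self, zero_mul]
    exact hε.le
  · calc (1 - u χ) * ‖χ b‖ ≤ 1 * ‖χ b‖ := by
          gcongr
          linarith [(hu01 χ).1]
      _ ≤ ε := by linarith

/-- The functional on compactly supported functions induced by a positive functional. -/
def compactlySupportedFunctional (φ : B →L[ℂ] ℂ) (hφ : ∀ b, 0 ≤ φ (star b * b)) :
    C_c(characterSpace ℂ B, ℝ) →ₚ[ℝ] ℝ :=
  PositiveLinearMap.mk₀
    { toFun := fun f => (φ (ofCompactlySupported f)).re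
      map_add' := fun f g => by simp [ofCompactlySupported_add]
      map_smul' := fun c f => by simp [ofCompactlySupported_smul] }
    fun f hf => by
      obtain ⟨b, hb⟩ := exists_star_mul_self_eq_ofCompactlySupported hf
      change 0 ≤ (φ (ofCompactlySupported f)).re
      rw [← hb]
      exact (Complex.nonneg_iff.1 (hφ b)).1

theorem compactlySupportedFunctional_apply (φ : B →L[ℂ] ℂ) (hφ : ∀ b, 0 ≤ φ (star b * b))
    (f : C_c(characterSpace ℂ B, ℝ)) :
    compactlySupportedFunctional φ hφ f = (φ (ofCompactlySupported f)).re :=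
  rfl

theorem ofReal_compactlySupportedFunctional (φ : B →L[ℂ] ℂ) (hφ : ∀ b, 0 ≤ φ (star b * b))
    (f : C_c(characterSpace ℂ B, ℝ)) :
    (compactlySupportedFunctional φ hφ f : ℂ) = φ (ofCompactlySupported f) := by
  have key : ∀ g : C_c(characterSpace ℂ B, ℝ), 0 ≤ g → (φ (ofCompactlySupported g)).im = 0 := by
    intro g hg
    obtain ⟨b, hb⟩ := exists_star_mul_self_eq_ofCompactlySupported hg
    rw [← hb]
    exact (Complex.nonneg_iff.1 (hφ b)).2.symm
  -- Realness extends from nonnegative functions by writing `f` as a difference of two of them.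
  have h1 := key (f ⊔ 0) le_sup_right
  have h2 := key ((f ⊔ 0) - f) (sub_nonneg.2 le_sup_left)
  have h3 : ofCompactlySupported (f ⊔ 0)
      = ofCompactlySupported ((f ⊔ 0) - f) + ofCompactlySupported f := by
    rw [← ofCompactlySupported_add, sub_add_cancel]
  rw [h3, map_add, Complex.add_im, h2, zero_add] at h1
  apply Complex.ext
  · simp [compactlySupportedFunctional_apply]
  · simp [h1]

section Riesz

variable [MeasurableSpace (characterSpace ℂ B)]

theorem integrable_apply [BorelSpace (characterSpace ℂ B)]
    (μ : Measure (characterSpace ℂ B)) [IsFiniteMeasure μ] (b : B) :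
    Integrable (fun χ : characterSpace ℂ B => χ b) μ :=
  .of_bound (continuous_apply b).aestronglyMeasurable ‖b‖ (.of_forall fun χ => norm_apply_le χ b)

theorem norm_integral_apply_le (μ : Measure (characterSpace ℂ B)) [IsFiniteMeasure μ] (b : B) :
    ‖∫ χ : characterSpace ℂ B, χ b ∂μ‖ ≤ ‖b‖ * μ.real Set.univ :=
  norm_integral_le_of_norm_le_const (.of_forall fun χ => norm_apply_le χ b)

/-- Integration of Gel'fand transforms as a linear functional. -/
def integralFunctional [BorelSpace (characterSpace ℂ B)] (μ : Measure (characterSpace ℂ B))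
    [IsFiniteMeasure μ] : B →ₗ[ℂ] ℂ where
  toFun b := ∫ χ : characterSpace ℂ B, χ b ∂μ
  map_add' a b := by
    rw [← integral_add (integrable_apply μ a) (integrable_apply μ b)]
    exact integral_congr_ae (.of_forall fun χ => map_add χ a b)
  map_smul' c a := by
    rw [RingHom.id_apply, ← integral_smul]
    exact integral_congr_ae (.of_forall fun χ => map_smul χ c a)

theorem integralFunctional_eq_of_ofCompactlySupported [BorelSpace (characterSpace ℂ B)]
    {φ : B →L[ℂ] ℂ} {μ : Measure (characterSpace ℂ B)} [IsFiniteMeasure μ]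
    (h : ∀ f, integralFunctional μ (ofCompactlySupported f) = φ (ofCompactlySupported f)) (b : B) :
    integralFunctional μ b = φ b := by
  have hC : 0 < μ.real Set.univ + ‖φ‖ + 1 := by positivity
  rw [← sub_eq_zero, ← norm_le_zero_iff]
  refine le_of_forall_pos_le_add fun ε hε => ?_
  obtain ⟨f, g, hfg⟩ := exists_norm_sub_le b (div_pos hε hC)
  set c := ofCompactlySupported f + Complex.I • ofCompactlySupported g with hc
  have hcφ : integralFunctional μ c = φ c := by
    rw [hc, map_add, map_add, map_smul, map_smul, h, h]
  have hsub : integralFunctional μ b - φ b = integralFunctional μ (b - c) - φ (b - c) := by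
    rw [map_sub, map_sub, hcφ]
    ring
  have h1 : ‖integralFunctional μ (b - c)‖ ≤ ‖b - c‖ * μ.real Set.univ :=
    norm_integral_apply_le μ (b - c)
  rw [hsub, zero_add]
  calc _ ≤ ‖integralFunctional μ (b - c)‖ + ‖φ (b - c)‖ := norm_sub_le _ _
    _ ≤ ‖b - c‖ * μ.real Set.univ + ‖φ‖ * ‖b - c‖ := add_le_add h1 (φ.le_opNorm _)
    _ ≤ ‖b - c‖ * (μ.real Set.univ + ‖φ‖ + 1) := by linarith [norm_nonneg (b - c)]
    _ ≤ ε / (μ.real Set.univ + ‖φ‖ + 1) * (μ.real Set.univ + ‖φ‖ + 1) := by gcongr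
    _ = ε := div_mul_cancel₀ _ hC.ne'

/-- **Riesz representation** of a positive functional of norm one on a commutative C*-algebra. -/
theorem exists_measure_integral_eq [BorelSpace (characterSpace ℂ B)]
    (φ : B →L[ℂ] ℂ) (hφ : ∀ b, 0 ≤ φ (star b * b))
    (hn : ‖φ‖ = 1) : ∃ μ : Measure (characterSpace ℂ B), IsProbabilityMeasure μ ∧ μ.Regular ∧
      ∀ b : B, ∫ χ : characterSpace ℂ B, χ b ∂μ = φ b := by
  set Λ := compactlySupportedFunctional φ hφ with hΛ
  let μ := RealRMK.rieszMeasure Λ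
  have hreg : μ.Regular := inferInstanceAs (RealRMK.rieszMeasure Λ).Regular
  have hle : μ Set.univ ≤ 1 := by
    rw [isOpen_univ.measure_eq_iSup_isCompact]
    refine iSup_le fun K => iSup_le fun _ => iSup_le fun hK => ?_
    obtain ⟨f, hf1, hf01⟩ := exists_compactlySupported_eq_one hK
    refine (RealRMK.rieszMeasure_le_of_eq_one Λ (fun χ => (hf01 χ).1) hK hf1).trans ?_
    rw [ENNReal.ofReal_le_one, hΛ, compactlySupportedFunctional_apply]
    calc (φ (ofCompactlySupported f)).re ≤ ‖φ (ofCompactlySupported f)‖ := Complex.re_le_norm _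
      _ ≤ ‖φ‖ * ‖ofCompactlySupported f‖ := φ.le_opNorm _
      _ ≤ 1 * 1 := by
          rw [hn]
          gcongr
          exact norm_ofCompactlySupported_le zero_le_one fun χ =>
            abs_le.2 ⟨by linarith [(hf01 χ).1], (hf01 χ).2⟩
      _ = 1 := one_mul 1
  have hfin : IsFiniteMeasure μ := ⟨hle.trans_lt ENNReal.one_lt_top⟩
  have hreal : μ.real Set.univ ≤ 1 := ENNReal.toReal_le_of_le_ofReal zero_le_one (by simpa)
  have hcs : ∀ f : C_c(characterSpace ℂ B, ℝ),
      ∫ χ : characterSpace ℂ B, χ (ofCompactlySupported f) ∂μ = φ (ofCompactlySupported f) := by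
    intro f
    simp_rw [apply_ofCompactlySupported]
    rw [integral_complex_ofReal, RealRMK.integral_rieszMeasure, hΛ,
      ofReal_compactlySupportedFunctional]
  have hint : ∀ b : B, ∫ χ : characterSpace ℂ B, χ b ∂μ = φ b :=
    integralFunctional_eq_of_ofCompactlySupported hcs
  refine ⟨μ, ?_, hreg, hint⟩
  -- No mass is missing: the total mass bounds the norm of the integral functional, which is φ.
  have hge : 1 ≤ μ.real Set.univ := by
    rw [← hn]
    refine φ.opNorm_le_bound measureReal_nonneg fun b => ?_
    rw [← hint b, mul_comm]
    exact norm_integral_apply_le μ b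
  have h1 : μ.real Set.univ = 1 := le_antisymm hreal hge
  exact ⟨(ENNReal.toReal_eq_one_iff _).1 h1⟩

end Riesz

end NonUnitalGelfand

end

/-! ### States and their restrictions to a topography -/

noncomputable section

namespace TopographicQuantumSpace

open WeakDual Topology CompactlySupported

section CauchySchwarz

variable {A : Type*} [NonUnitalCStarAlgebra A]

/-- The Cauchy–Schwarz inequality for positive functionals. -/
theorem norm_sq_apply_star_mul_le (φ : A →L[ℂ] ℂ) (hφ : ∀ a, 0 ≤ φ (star a * a)) (a b : A) :
    ‖φ (star a * b)‖ ^ 2 ≤ ‖φ (star a * a)‖ * ‖φ (star b * b)‖ := by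
  let _ := CStarAlgebra.spectralOrder A
  let _ := CStarAlgebra.spectralOrderedRing A
  -- The inequality is the one for the GNS semi-inner product of φ.
  let f : A →ₚ[ℂ] ℂ := PositiveLinearMap.mk₀ φ.toLinearMap fun x hx => by
    obtain ⟨y, rfl⟩ := CStarAlgebra.nonneg_iff_eq_star_mul_self.1 hx
    exact hφ y
  have hf : ∀ x : A, ‖φ (star x * x)‖ = ‖f.toPreGNS x‖ ^ 2 := fun x => by
    have h := f.preGNS_norm_sq (f.toPreGNS x)
    rw [f.ofPreGNS_toPreGNS] at h
    change _ = φ (star x * x) at h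
    rw [← h, ← Complex.ofReal_pow, Complex.norm_real, Real.norm_of_nonneg (sq_nonneg _)]
  rw [hf, hf, ← mul_pow]
  gcongr
  exact norm_inner_le_norm (𝕜 := ℂ) (f.toPreGNS a) (f.toPreGNS b)

end CauchySchwarz

variable {A : Type*} [NonUnitalCStarAlgebra A] {M : NonUnitalStarSubalgebra ℂ A}

/-- The subalgebra of a topography is a commutative C*-algebra. -/
abbrev IsTopography.nonUnitalCommCStarAlgebra (hM : IsTopography M) :
    NonUnitalCommCStarAlgebra M :=
  letI := NonUnitalStarSubalgebra.nonUnitalCStarAlgebra M (h_closed := hM.isClosed)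
  { mul_comm := fun x y => Subtype.ext (hM.abelian x x.2 y y.2) }

/-- A topography contains contractions that are approximate units for each single element. -/
theorem IsTopography.exists_norm_mul_sub_lt (hM : IsTopography M) (a : A) {ε : ℝ} (hε : 0 < ε) :
    ∃ u : M, ‖u‖ ≤ 1 ∧ ‖(u : A) * a - a‖ < ε := by
  let _ := hM.nonUnitalCommCStarAlgebra
  let _ := CStarAlgebra.spectralOrder M
  let _ := CStarAlgebra.spectralOrderedRing M
  obtain ⟨l, hl, hMl⟩ := hM.exists_approximateUnit
  have := hl.neBot
  obtain ⟨e, he, heM⟩ := (((Metric.tendsto_nhds.1 (hl.tendsto_mul_right a)) (ε / 4)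
    (by positivity)).and hMl).exists
  lift e to M using heM
  rw [dist_eq_norm] at he
  -- The filter `l` need not contain contractions. Those of `M` fix `e` approximately, and `e` fixes
  -- `a` approximately.
  have hu := CStarAlgebra.increasingApproximateUnit M
  have := hu.neBot
  obtain ⟨u, hue, hu1⟩ := ((Metric.tendsto_nhds.1 (hu.tendsto_mul_right e) (ε / 4 / (‖a‖ + 1))
    (by positivity)).and hu.eventually_norm).exists
  rw [dist_eq_norm] at hue
  refine ⟨u, hu1, ?_⟩
  have hue' : ‖(u : A) * e - e‖ < ε / 4 / (‖a‖ + 1) := hue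
  have hu1' : ‖(u : A)‖ ≤ 1 := hu1
  have h1 : ‖((u : A) * e - e) * a‖ ≤ ε / 4 := calc
    _ ≤ ‖(u : A) * e - e‖ * ‖a‖ := norm_mul_le _ _
    _ ≤ ε / 4 / (‖a‖ + 1) * (‖a‖ + 1) := by gcongr; linarith
    _ = ε / 4 := by field_simp
  have h2 : ‖(u : A) * (e * a - a)‖ ≤ ε / 4 := calc
    _ ≤ ‖(u : A)‖ * ‖e * a - a‖ := norm_mul_le _ _
    _ ≤ 1 * (ε / 4) := by gcongr
    _ = ε / 4 := one_mul _
  have h3 : (u : A) * a - a = ((u : A) * e - e) * a - (u : A) * (e * a - a) + (e * a - a) := by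
    noncomm_ring
  rw [h3]
  linarith [norm_add_le (((u : A) * e - e) * a - (u : A) * (e * a - a)) (e * a - a),
    norm_sub_le (((u : A) * e - e) * a) ((u : A) * (e * a - a))]

/-- The restriction of a functional to a subalgebra. -/
def restrict (M : NonUnitalStarSubalgebra ℂ A) (φ : WeakDual ℂ A) : M →L[ℂ] ℂ :=
  (WeakDual.toStrongDual φ).comp
    (⟨{ toFun := fun m => (m : A)
        map_add' := fun _ _ => rfl
        map_smul' := fun _ _ => rfl }, continuous_subtype_val⟩ : M →L[ℂ] A)

theorem norm_apply_le_of_norm_le_one {φ : WeakDual ℂ A} (hφ : ‖WeakDual.toStrongDual φ‖ ≤ 1)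
    (a : A) : ‖φ a‖ ≤ ‖a‖ := by
  simpa using (WeakDual.toStrongDual φ).le_of_opNorm_le hφ a

/-- A state of `A` restricts to a functional of norm one on a topography. -/
theorem IsTopography.norm_restrict (hM : IsTopography M) {φ : WeakDual ℂ A}
    (hφ : φ ∈ stateSpace A) : ‖restrict M φ‖ = 1 := by
  have hle : ∀ a, ‖φ a‖ ≤ ‖a‖ := norm_apply_le_of_norm_le_one hφ.2.le
  refine le_antisymm ((restrict M φ).opNorm_le_bound zero_le_one fun m => ?_) ?_
  · rw [one_mul]
    exact hle m
  -- Cauchy–Schwarz puts `u * star u`, which lies in `M`, into one factor. Letting `u * a` approach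
  -- `a` then yields 1 = ‖φ‖ ≤ √‖φ|_M‖.
  have key : ∀ u : M, ‖u‖ ≤ 1 → ∀ a : A,
      ‖φ ((u : A) * a)‖ ≤ √‖restrict M φ‖ * ‖a‖ := fun u hu a => by
    have h := norm_sq_apply_star_mul_le (WeakDual.toStrongDual φ) hφ.1 (star (u : A)) a
    rw [star_star] at h
    have h1 : ‖φ ((u : A) * star (u : A))‖ ≤ ‖restrict M φ‖ := by
      refine (restrict M φ).le_of_opNorm_le_of_le le_rfl (x := u * star u) (b := 1) ?_ |>.trans_eq
        (mul_one _)
      calc ‖u * star u‖ ≤ ‖u‖ * ‖star u‖ := norm_mul_le _ _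
        _ ≤ 1 * 1 := by
          gcongr
          change ‖star (u : A)‖ ≤ 1
          rwa [norm_star]
        _ = 1 := one_mul 1
    have h2 : ‖φ (star a * a)‖ ≤ ‖a‖ ^ 2 := (hle _).trans_eq (by
      rw [CStarRing.norm_star_mul_self, sq])
    refine abs_le_of_sq_le_sq' ?_ (by positivity) |>.2
    rw [mul_pow, Real.sq_sqrt (restrict M φ).opNorm_nonneg]
    exact h.trans (mul_le_mul h1 h2 (norm_nonneg _) (norm_nonneg _))
  have h1 : ‖WeakDual.toStrongDual φ‖ ≤ √‖restrict M φ‖ := by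
    refine ContinuousLinearMap.opNorm_le_bound _ (Real.sqrt_nonneg _) fun a => ?_
    refine le_of_forall_pos_le_add fun ε hε => ?_
    obtain ⟨u, hu, hua⟩ := hM.exists_norm_mul_sub_lt a hε
    have h2 : φ a = φ ((u : A) * a) - φ ((u : A) * a - a) := by rw [map_sub]; ring
    change ‖φ a‖ ≤ _
    rw [h2]
    linarith [norm_sub_le (φ ((u : A) * a)) (φ ((u : A) * a - a)), key u hu a,
      hle ((u : A) * a - a)]
  rw [hφ.2] at h1
  exact Real.one_le_sqrt.1 h1

theorem IsTopography.exists_represents (hM : IsTopography M) {φ : WeakDual ℂ A}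
    (hφ : φ ∈ stateSpace A) : ∃ μ : Measure (GelfandSpectrum M), Represents M φ μ := by
  let _ := hM.nonUnitalCommCStarAlgebra
  obtain ⟨μ, h1, h2, h3⟩ := NonUnitalGelfand.exists_measure_integral_eq (B := M) (restrict M φ)
    (fun m => hφ.1 m) (hM.norm_restrict hφ)
  exact ⟨μ, h1, h2, h3⟩

theorem IsTopography.represents_stateMeasure (hM : IsTopography M) {φ : WeakDual ℂ A}
    (hφ : φ ∈ stateSpace A) : Represents M φ (stateMeasure M φ) := by
  have h := hM.exists_represents hφ
  rw [stateMeasure, dif_pos h]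
  exact h.choose_spec

/-- Urysohn functions on the Gel'fand spectrum come from contractions in `M`. -/
theorem IsTopography.exists_apply_eq_one (hM : IsTopography M) {K : Set (GelfandSpectrum M)}
    (hK : IsCompact K) : ∃ (m : M) (f : C_c(GelfandSpectrum M, ℝ)), ‖m‖ ≤ 1 ∧
      (∀ χ : GelfandSpectrum M, χ m = f χ) ∧ (∀ χ ∈ K, f χ = 1) ∧
      ∀ χ : GelfandSpectrum M, 0 ≤ f χ ∧ f χ ≤ 1 := by
  let _ := hM.nonUnitalCommCStarAlgebra
  obtain ⟨f, hf1, hf01⟩ := NonUnitalGelfand.exists_compactlySupported_eq_one (B := M) hK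
  exact ⟨NonUnitalGelfand.ofCompactlySupported f, f,
    NonUnitalGelfand.norm_ofCompactlySupported_le zero_le_one fun χ =>
      abs_le.2 ⟨by linarith [(hf01 χ).1], (hf01 χ).2⟩,
    NonUnitalGelfand.apply_ofCompactlySupported f, hf1, hf01⟩

/-! ### Comparing masses of compact sets with values of the functional -/

section Represents

variable {φ : WeakDual ℂ A} {μ : Measure (GelfandSpectrum M)}

theorem Represents.re_apply_eq (h : Represents M φ μ) {m : M} {f : GelfandSpectrum M → ℝ}
    (hf : ∀ χ : GelfandSpectrum M, χ m = f χ) : (φ (m : A)).re = ∫ χ, f χ ∂μ := by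
  rw [← h.integral_eq m]
  simp_rw [hf]
  rw [integral_complex_ofReal, Complex.ofReal_re]

theorem Represents.measureReal_le_re_apply (h : Represents M φ μ) {m : M}
    {f : C_c(GelfandSpectrum M, ℝ)} (hf : ∀ χ : GelfandSpectrum M, χ m = f χ)
    (hf0 : ∀ χ, 0 ≤ f χ) {K : Set (GelfandSpectrum M)} (hK : IsCompact K)
    (hf1 : ∀ χ ∈ K, f χ = 1) : μ.real K ≤ (φ (m : A)).re := by
  have := h.isProbabilityMeasure
  rw [h.re_apply_eq hf, ← integral_indicator_one hK.measurableSet]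
  refine integral_mono ((integrable_const 1).indicator hK.measurableSet)
    (f.continuous.integrable_of_hasCompactSupport f.hasCompactSupport) fun χ => ?_
  refine Set.indicator_le' (fun χ hχ => ?_) (fun χ _ => hf0 χ) χ
  exact (hf1 χ hχ).ge

theorem Represents.re_apply_le_measureReal (h : Represents M φ μ) {m : M}
    {f : C_c(GelfandSpectrum M, ℝ)} (hf : ∀ χ : GelfandSpectrum M, χ m = f χ)
    (hf1 : ∀ χ, f χ ≤ 1) {K : Set (GelfandSpectrum M)} (hK : IsCompact K)
    (hfK : tsupport f ⊆ K) : (φ (m : A)).re ≤ μ.real K := by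
  have := h.isProbabilityMeasure
  rw [h.re_apply_eq hf, ← integral_indicator_one hK.measurableSet]
  refine integral_mono (f.continuous.integrable_of_hasCompactSupport f.hasCompactSupport)
    ((integrable_const 1).indicator hK.measurableSet) fun χ => ?_
  by_cases hχ : χ ∈ K
  · simpa [hχ] using hf1 χ
  · simp [hχ, image_eq_zero_of_notMem_tsupport fun h' => hχ (hfK h')]

theorem Represents.exists_isCompact_lt_measureReal (h : Represents M φ μ) {r : ℝ} (hr : r < 1) :
    ∃ K : Set (GelfandSpectrum M), IsCompact K ∧ r < μ.real K := by
  have := h.isProbabilityMeasure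
  have := h.regular
  have h1 : ENNReal.ofReal r < μ Set.univ := by
    rw [measure_univ]
    exact ENNReal.ofReal_lt_one.2 hr
  obtain ⟨K, -, hK, hrK⟩ := isOpen_univ.exists_lt_isCompact h1
  exact ⟨K, hK, lt_of_not_ge fun h' =>
    hrK.not_ge ((ofReal_measureReal (s := K) (μ := μ)).symm.trans_le (ENNReal.ofReal_le_ofReal h'))⟩

end Represents

/-! ### Tightness and weak* closure -/

section Tight

variable {S : Set (WeakDual ℂ A)}

/-- Needed because `sSup` of an unbounded real set is 0 by default, so a bound on it would say
nothing about the members. -/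
theorem bddAbove_massOutside (K : Set (GelfandSpectrum M)) :
    BddAbove ((fun φ => massOutside M φ K) '' S) := by
  refine ⟨1, ?_⟩
  rintro _ ⟨φ, -, rfl⟩
  exact sub_le_self 1 measureReal_nonneg

theorem isCompact_closure_of_subset_stateSpace (hS : S ⊆ stateSpace A) :
    IsCompact (closure S) :=
  (WeakDual.isCompact_closedBall (𝕜 := ℂ) (E := A) 0 1).of_isClosed_subset isClosed_closure
    (closure_minimal (fun φ hφ => by simpa using (hS hφ).2.le)
      (WeakDual.isClosed_closedBall 0 1))

/-- Tightness supplies, for each `ε`, one contraction `m` in `M` with `1 - ε ≤ Re ψ(m)` for all ψ in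
`S`. This inequality survives weak* limits and keeps their norm at one. -/
theorem closure_subset_stateSpace_of_isTight (hM : IsTopography M) (hS : S ⊆ stateSpace A)
    (hT : IsTight M S) : closure S ⊆ stateSpace A := by
  intro φ hφ
  have hpos : ∀ a : A, 0 ≤ φ (star a * a) := fun a =>
    closure_minimal (s := S) (t := {ψ : WeakDual ℂ A | 0 ≤ ψ (star a * a)})
      (fun ψ hψ => (hS hψ).1 a)
      (isClosed_le continuous_const (WeakDual.eval_continuous (star a * a))) hφ
  have hle : ‖WeakDual.toStrongDual φ‖ ≤ 1 := by
    have : φ ∈ WeakDual.toStrongDual ⁻¹' Metric.closedBall (0 : StrongDual ℂ A) 1 :=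
      closure_minimal (fun ψ hψ => by simpa using (hS hψ).2.le)
        (WeakDual.isClosed_closedBall 0 1) hφ
    simpa using this
  refine ⟨hpos, le_antisymm hle (le_of_forall_sub_le fun ε hε => ?_)⟩
  obtain ⟨Q, hQ, hQε⟩ := hT ε hε
  obtain ⟨m, f, hm, hmf, hf1, hf01⟩ := hM.exists_apply_eq_one hQ
  have hψ : ∀ ψ ∈ S, 1 - ε ≤ (ψ (m : A)).re := fun ψ hψ => by
    have h1 : massOutside M ψ Q < ε :=
      (le_csSup (bddAbove_massOutside Q) ⟨ψ, hψ, rfl⟩).trans_lt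
        (hQε Q hQ subset_rfl)
    have h2 := (hM.represents_stateMeasure (hS hψ)).measureReal_le_re_apply hmf
      (fun χ => (hf01 χ).1) hQ hf1
    rw [massOutside] at h1
    linarith
  have h1 : 1 - ε ≤ (φ (m : A)).re :=
    closure_minimal (s := S) (t := {ψ : WeakDual ℂ A | 1 - ε ≤ (ψ (m : A)).re}) hψ
      (isClosed_le continuous_const
        (Complex.continuous_re.comp (WeakDual.eval_continuous (m : A)))) hφ
  calc 1 - ε ≤ ‖φ (m : A)‖ := h1.trans (Complex.re_le_norm _)
    _ ≤ ‖WeakDual.toStrongDual φ‖ :=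
      (WeakDual.toStrongDual φ).unit_le_opNorm (m : A) hm

/-- Each φ in the closure is a state, so its measure is nearly concentrated on a compact set; a
Urysohn element carries this to a neighbourhood of φ, and finitely many neighbourhoods suffice. -/
theorem isTight_of_closure_subset_stateSpace (hM : IsTopography M)
    (hS : closure S ⊆ stateSpace A) (hc : IsCompact (closure S)) : IsTight M S := by
  intro ε hε
  have hlocal : ∀ φ ∈ closure S, ∃ U ∈ 𝓝 φ, ∃ Q : Set (GelfandSpectrum M), IsCompact Q ∧
      ∀ ψ ∈ U, ψ ∈ S → ∀ K : Set (GelfandSpectrum M), IsCompact K → Q ⊆ K →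
        1 - ε / 2 ≤ (stateMeasure M ψ).real K := by
    intro φ hφ
    have hrep := hM.represents_stateMeasure (hS hφ)
    obtain ⟨K₀, hK₀, hlt⟩ :=
      hrep.exists_isCompact_lt_measureReal (r := 1 - ε / 2) (by linarith)
    obtain ⟨m, f, -, hmf, hf1, hf01⟩ := hM.exists_apply_eq_one hK₀
    have hφm : 1 - ε / 2 < (φ (m : A)).re :=
      hlt.trans_le (hrep.measureReal_le_re_apply hmf (fun χ => (hf01 χ).1) hK₀ hf1)
    refine ⟨{ψ | 1 - ε / 2 < (ψ (m : A)).re}, (isOpen_lt continuous_const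
      (Complex.continuous_re.comp (WeakDual.eval_continuous (m : A)))).mem_nhds hφm,
      tsupport f, f.hasCompactSupport, fun ψ hψ hψS K hK hfK => ?_⟩
    exact (le_of_lt hψ).trans ((hM.represents_stateMeasure
      (hS (subset_closure hψS))).re_apply_le_measureReal hmf (fun χ => (hf01 χ).2) hK hfK)
  choose! U hU Q hQ hUQ using hlocal
  obtain ⟨t, ht, hcover⟩ := hc.elim_nhds_subcover U hU
  refine ⟨⋃ φ ∈ t, Q φ, t.isCompact_biUnion fun φ hφ => hQ φ (ht φ hφ), fun K hK hQK => ?_⟩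
  -- The margin `ε / 2` keeps the inequality strict after the supremum; its nonnegativity covers
  -- empty `S`.
  refine lt_of_le_of_lt (Real.sSup_le ?_ (half_pos hε).le) (half_lt_self hε)
  rintro _ ⟨ψ, hψ, rfl⟩
  obtain ⟨φ, hφ, hψU⟩ := Set.mem_iUnion₂.1 (hcover (subset_closure hψ))
  have := hUQ φ (ht φ hφ) ψ hψU hψ K hK
    ((Set.subset_biUnion_of_mem (u := fun φ => Q φ) hφ).trans hQK)
  simp only [massOutside]
  linarith

end Tight

end TopographicQuantumSpace

end

theorem mainTheorem4 {A : Type*} [NonUnitalCStarAlgebra A]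
    (M : NonUnitalStarSubalgebra ℂ A) (hM : TopographicQuantumSpace.IsTopography M)
    (S : Set (WeakDual ℂ A)) (hS : S ⊆ TopographicQuantumSpace.stateSpace A) :
    TopographicQuantumSpace.IsTight M S ↔
      closure S ⊆ TopographicQuantumSpace.stateSpace A ∧ IsCompact (closure S) :=
  ⟨fun h => ⟨TopographicQuantumSpace.closure_subset_stateSpace_of_isTight hM hS h,
    TopographicQuantumSpace.isCompact_closure_of_subset_stateSpace hS⟩,
    fun h => TopographicQuantumSpace.isTight_of_closure_subset_stateSpace hM h.1 h.2⟩
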